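/- Let $\mathbb{N}=\{0,1,2,\dots\}$. For positive integers $j,n$ let $\sigma_j(n)=\sum_{d\mid n}d^j$, the sum over the positive divisors $d$ of $n$, and set $\sigma_j(x)=0$ if $x$ is not a positive integer. Let $\tau(n)$ be defined by $$\Delta(z)=e^{2\pi i z}\prod_{m\ge 1}\left(1-e^{2\pi i m z}\right)^{24}=\sum_{n\ge 1}\tau(n)e^{2\pi i n z}\qquad(\operatorname{Im} z>0).$$ For nonnegative integers $a_1,\dots,a_r$ and odd positive integers $b_1,\dots,b_r$ put $$S[(a_1,\dots,a_r),(b_1,\dots,b_r)](n)=\sum_{\substack{(m_1,\dots,m_r)\in\mathbb{N}^r\\ m_1+\dots+m_r=n}} m_1^{a_1}\cdots m_r^{a_r}\,\sigma_{b_1}(m_1)\cdots\sigma_{b_r}(m_r).$$ **Theorem.** For every integer $n\ge 1$, $$S[(0,1,1),(1,1,1)](n)=\frac{1}{288}n^2\sigma_5(n)-\frac{1}{72}n^3\sigma_3(n)+\frac{1}{288}n^2\sigma_3(n)+\frac{1}{96}n^4\sigma_1(n)-\frac{1}{288}n^3\sigma_1(n),$$ and $$\begin{aligned} -24^5\,S[(0,0,0,1,1),(1,1,1,1,1)](n)={}&-\frac{48}{5}n^2\sigma_9(n)+128n^3\sigma_7(n)-80n^2\sigma_7(n)-600n^4\sigma_5(n)+648n^3\sigma_5(n)\\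 &+\frac{8208}{7}n^5\sigma_3(n)-144n^2\sigma_5(n)-\frac{11232}{7}n^4\sigma_3(n)-\frac{3456}{5}n^6\sigma_1(n)\\ &+576n^3\sigma_3(n)+\frac{5184}{5}n^5\sigma_1(n)-432n^4\sigma_1(n)-48n^2\sigma_3(n)+48n^3\sigma_1(n)\\ &+\frac{8}{35}n\tau(n)-\frac{8}{35}\tau(n). \end{aligned}$$ -/

import Mathlib

/-- The Ramanujan function: `ramanujanTau n` is the `n`-th Fourier coefficient, in `q = e^{2πiz}`
(period `1`), of the modular discriminant `Δ(z) = q ∏_{m ≥ 1} (1 - q^m)^24`. -/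
noncomputable def ramanujanTau (n : ℕ) : ℂ :=
  (UpperHalfPlane.qExpansion 1 ModularForm.discriminant).coeff n

/-- `σ_j(m / N)`, which is `0` when `m / N` is not a positive integer. Note that Mathlib's
`ArithmeticFunction.sigma j 0` is `0`. -/
def sigmaQuot (j m N : ℕ) : ℕ :=
  if N ∣ m then ArithmeticFunction.sigma j (m / N) else 0

/-- The Lahiri-type sum `S[(a₁,…,a_r),(b₁,…,b_r),(N₁,…,N_r)](n)`, over all `(m₁,…,m_r) ∈ ℕ^r`
with `m₁ + … + m_r = n`. -/
def lahiriSumLevel {r : ℕ} (a b N : Fin r → ℕ) (n : ℕ) : ℕ :=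
  ∑ m ∈ Finset.Nat.antidiagonalTuple r n, ∏ i, m i ^ a i * sigmaQuot (b i) (m i) (N i)

/-- The Lahiri-type sum `S[(a₁,…,a_r),(b₁,…,b_r)](n)`, in which all `N_i` are `1`. -/
def lahiriSum {r : ℕ} (a b : Fin r → ℕ) (n : ℕ) : ℕ :=
  lahiriSumLevel a b (fun _ => 1) n

open ArithmeticFunction

/-!
Let `P = E₂`, `Q = E₄`, `R = E₆` be the `q`-expansions of the Eisenstein series and `θ = q d/dq`.
Since `∑ σ₁(m) q^m = (1 - P) / 24` and `∑ m σ₁(m) q^m = -θ P / 24`, the two sums are the `n`-th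
coefficients of `(1 - P) (θ P)² / 24³` and `(1 - P)³ (θ P)² / 24⁵` (`cast_lahiriSum`).

Ramanujan's differential equations `12 θP = P² - Q`, `3 θQ = PQ - R`, `2 θR = PR - Q²`
(`eulerDerivation_P`, `eulerDerivation_Q`, `eulerDerivation_R`) make `ℂ[P, Q, R]` stable under `θ`.
The two products above are elements of this ring, and so are the iterated derivatives of `P`, `Q`,
`R`, of `E₈ = Q²` and `E₁₀ = QR` (`Q_sq`, `Q_mul_R`), and of `Δ = (Q³ - R²) / 1728`. Coefficients
of the latter are `n^k σ_j(n)`, `τ(n)` and `n τ(n)` up to constants, so that the theorem becomes two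
polynomial identities in `P, Q, R` (`IsRamanujanSystem.one_sub_mul_sq` and
`IsRamanujanSystem.one_sub_cube_mul_sq`), which hold by expansion.

The differential equations and the formulas for `E₈` and `E₁₀` are equalities of level-one modular
forms of weight less than `12`. In these weights there are no nonzero cusp forms, so a comparison of
constant terms is enough (`HasQExpansion.eq_of_slash_invariant`). Modularity comes from the Serre
derivative; for the equation for `θ P` it is derived from the transformation of `E2`
(`serreDerivative_one_E2_slash`).
-/

/-! ### Functions with a q-expansion -/

section QExpansions

open UpperHalfPlane hiding I
open Complex ModularForm EisensteinSeries Derivative Function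
open scoped MatrixGroups Manifold Topology

local notation "𝕢" => Periodic.qParam

/-- The function `f` on the upper half plane is holomorphic and is the sum of the power series `p`
in `q = e^{2πiz}`. No modularity is asked for, so that `E2` and derivatives of modular forms are
covered. -/
structure HasQExpansion (f : ℍ → ℂ) (p : PowerSeries ℂ) : Prop where
  mdiff : MDiff f
  hasSum : ∀ τ : ℍ, HasSum (fun m ↦ p.coeff m • 𝕢 1 τ ^ m) (f τ)

namespace HasQExpansion

variable {f g : ℍ → ℂ} {p r : PowerSeries ℂ}

lemma periodic (hf : HasQExpansion f p) : Periodic (f ∘ ofComplex) 1 := by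
  intro w
  by_cases! hw : 0 < im w
  · have hw' : 0 < im (w + 1) := by simpa using hw
    simp only [comp_apply, ofComplex_apply_of_im_pos hw, ofComplex_apply_of_im_pos hw']
    refine (hf.hasSum ⟨w + 1, hw'⟩).unique ?_
    have := hf.hasSum ⟨w, hw⟩
    rwa [show 𝕢 1 (⟨w, hw⟩ : ℍ) = 𝕢 1 (⟨w + 1, hw'⟩ : ℍ) by
      simp [Periodic.qParam, mul_add, Complex.exp_add]] at this
  · have : im (w + 1) ≤ 0 := by simpa using hw
    simp [ofComplex_apply_of_im_nonpos this, ofComplex_apply_of_im_nonpos hw]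

lemma isBoundedAtImInfty (hf : HasQExpansion f p) : IsBoundedAtImInfty f :=
  isBoundedAtImInfty_of_hasSum_qExpansion one_pos hf.hasSum

lemma qExpansion_eq (hf : HasQExpansion f p) : qExpansion 1 f = p := by
  have hper : Periodic (f ∘ ofComplex) (1 : ℝ) := by exact_mod_cast hf.periodic
  have han := analyticAt_cuspFunction_zero one_pos hper hf.mdiff hf.isBoundedAtImInfty
  have h1 := (hasFPowerSeriesOnBall_cuspFunction one_pos han hf.hasSum).hasFPowerSeriesAt
  have h2 := (hasFPowerSeriesOnBall_cuspFunction one_pos han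
    (hasSum_qExpansion one_pos hper hf.mdiff hf.isBoundedAtImInfty)).hasFPowerSeriesAt
  ext n
  simpa using congr_arg (FormalMultilinearSeries.coeff · n) (h2.eq_formalMultilinearSeries h1)

lemma sub (hf : HasQExpansion f p) (hg : HasQExpansion g r) : HasQExpansion (f - g) (p - r) where
  mdiff := hf.mdiff.sub hg.mdiff
  hasSum τ := by simpa [sub_mul] using (hf.hasSum τ).sub (hg.hasSum τ)

lemma smul (hf : HasQExpansion f p) (c : ℂ) : HasQExpansion (c • f) (c • p) where
  mdiff := hf.mdiff.const_smul c
  hasSum τ := by simpa [mul_assoc] using (hf.hasSum τ).mul_left c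

lemma mul (hf : HasQExpansion f p) (hg : HasQExpansion g r) : HasQExpansion (f * g) (p * r) where
  mdiff := hf.mdiff.mul hg.mdiff
  hasSum τ := by
    have hs := (summable_norm_sum_mul_antidiagonal_of_summable_norm
      (hf.hasSum τ).summable.norm (hg.hasSum τ).summable.norm).of_norm.hasSum
    rw [← tsum_mul_tsum_eq_tsum_sum_antidiagonal_of_summable_norm
      (hf.hasSum τ).summable.norm (hg.hasSum τ).summable.norm, (hf.hasSum τ).tsum_eq,
      (hg.hasSum τ).tsum_eq] at hs
    convert! hs using 2 with n
    rw [PowerSeries.coeff_mul, Finset.sum_smul]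
    refine Finset.sum_congr rfl fun ij hij ↦ ?_
    rw [← Finset.HasAntidiagonal.mem_antidiagonal.mp hij, pow_add]
    simp only [smul_eq_mul]
    ring

end HasQExpansion

/-- The Euler operator `q d/dq` on power series, which multiplies the `n`-th coefficient by `n`. -/
noncomputable def eulerDerivation : Derivation ℂ (PowerSeries ℂ) (PowerSeries ℂ) :=
  (PowerSeries.X : PowerSeries ℂ) • PowerSeries.derivative ℂ

lemma coeff_eulerDerivation (p : PowerSeries ℂ) (n : ℕ) :
    (eulerDerivation p).coeff n = n * p.coeff n := by
  cases n with
  | zero => simp [eulerDerivation]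
  | succ n =>
    simp only [eulerDerivation, Derivation.smul_apply, smul_eq_mul, PowerSeries.coeff_succ_X_mul,
      PowerSeries.coeff_derivative]
    push_cast
    ring

/-- The operator `(2πi)⁻¹ d/dz` on functions is `q d/dq` on `q`-expansions. -/
lemma HasQExpansion.normalizedDeriv {f : ℍ → ℂ} {p : PowerSeries ℂ} (hf : HasQExpansion f p) :
    HasQExpansion (normalizedDerivOfComplex f) (eulerDerivation p) where
  mdiff := normalizedDerivOfComplex_mdifferentiable hf.mdiff
  hasSum τ := by
    have hper : Periodic (f ∘ ofComplex) (1 : ℝ) := by exact_mod_cast hf.periodic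
    have hdiff := differentiableOn_cuspFunction_ball one_pos hper hf.mdiff hf.isBoundedAtImInfty
    have hq : ‖𝕢 1 (τ : ℂ)‖ < 1 := Periodic.norm_qParam_lt_one one_pos τ.im_pos
    have hq' : 𝕢 1 (τ : ℂ) ∈ Metric.ball (0 : ℂ) 1 := by simpa using hq
    have hderiv : normalizedDerivOfComplex f τ
        = 𝕢 1 (τ : ℂ) * deriv (cuspFunction 1 f) (𝕢 1 (τ : ℂ)) := by
      have h1 : HasDerivAt (𝕢 1) (𝕢 1 (τ : ℂ) * (2 * Real.pi * I)) (τ : ℂ) := by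
        have := ((hasDerivAt_id (τ : ℂ)).const_mul (2 * Real.pi * I)).cexp
        simpa [show 𝕢 1 = fun z : ℂ ↦ cexp (2 * Real.pi * I * z) by ext; simp [Periodic.qParam]]
          using this
      have h2 : HasDerivAt (cuspFunction 1 f) (deriv (cuspFunction 1 f) (𝕢 1 (τ : ℂ)))
          (𝕢 1 (τ : ℂ)) :=
        (hdiff.differentiableAt (Metric.isOpen_ball.mem_nhds hq')).hasDerivAt
      -- This also holds off the upper half plane, where `ofComplex` takes a junk value,
      -- because `cuspFunction` is defined through `f ∘ ofComplex`.
      have h3 : f ∘ ofComplex = cuspFunction 1 f ∘ 𝕢 1 := by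
        funext w
        exact (Periodic.eq_cuspFunction one_ne_zero hper w).symm
      rw [normalizedDerivOfComplex, h3, (h2.comp (τ : ℂ) h1).deriv]
      field_simp [two_pi_I_ne_zero]
    have hs := Complex.hasSum_taylorSeries_on_ball (hdiff.deriv Metric.isOpen_ball) hq'
    rw [hderiv, ← hasSum_nat_add_iff' 1]
    convert! hs.mul_left (𝕢 1 (τ : ℂ)) using 1
    · funext n
      rw [coeff_eulerDerivation, ← hf.qExpansion_eq, qExpansion_coeff, iteratedDeriv_succ',
        Nat.factorial_succ]
      have : (n.factorial : ℂ) ≠ 0 := by exact_mod_cast n.factorial_ne_zero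
      push_cast
      simp only [smul_eq_mul, sub_zero]
      field_simp
      ring
    · simp [coeff_eulerDerivation]

/-- There is no nonzero cusp form of level one and weight less than `12`. Boundedness at the cusp is
part of having a `q`-expansion, and vanishing there is the condition on the constant term. -/
lemma HasQExpansion.eq_zero_of_slash_invariant {k : ℕ} (hk : k < 12) {f : ℍ → ℂ}
    {p : PowerSeries ℂ} (hf : HasQExpansion f p) (hslash : ∀ γ : SL(2, ℤ), f ∣[(k : ℤ)] γ = f)
    (h0 : p.coeff 0 = 0) : p = 0 := by
  let F : ModularForm 𝒮ℒ (k : ℤ) :=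
    { toFun := f
      slash_action_eq' := by
        rintro _ ⟨γ, rfl⟩
        exact hslash γ
      holo' := hf.mdiff
      bdd_at_cusps' := fun hc ↦ by
        rw [Subgroup.IsArithmetic.isCusp_iff_isCusp_SL2Z] at hc
        rw [OnePoint.isBoundedAt_iff_forall_SL2Z hc]
        intro γ _
        rw [hslash γ]
        exact hf.isBoundedAtImInfty }
  have hq : qExpansion 1 F = p := hf.qExpansion_eq
  have hF : F = 0 := by
    apply sturm_bound_levelOne_nat
    rw [hq, Nat.div_eq_of_lt hk]
    refine lt_of_lt_of_le (b := 1) (by simp) (PowerSeries.le_order _ _ fun i hi ↦ ?_)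
    have : i = 0 := by
      have : i < 1 := by exact_mod_cast hi
      omega
    rw [this, h0]
  rw [← hq, hF]
  exact qExpansion_zero 1

/-! ### Eisenstein series -/

/-- The power series `1 + c ∑_{n ≥ 1} σ_j(n) q^n`, the shape of the `q`-expansion of a normalised
Eisenstein series of weight `j + 1`. -/
noncomputable def eisensteinSeriesQ (c : ℂ) (j : ℕ) : PowerSeries ℂ :=
  PowerSeries.mk fun n ↦ if n = 0 then 1 else c * sigma j n

lemma hasQExpansion_E {k : ℕ} (hk : 3 ≤ k) (hk2 : Even k) {c : ℂ}
    (hc : -(2 * k / bernoulli k : ℂ) = c) :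
    HasQExpansion (E hk) (eisensteinSeriesQ c (k - 1)) where
  mdiff := (E hk).holo'
  hasSum τ := by
    have h := hasSum_qExpansion one_pos (SlashInvariantFormClass.periodic_comp_ofComplex (E hk)
      one_mem_strictPeriods_SL) (E hk).holo' (ModularFormClass.bdd_at_infty (E hk)) τ
    convert! h using 3 with m
    rw [E_qExpansion_coeff hk hk2, ← hc]
    simp [eisensteinSeriesQ]

lemma hasQExpansion_E2 : HasQExpansion E2 (eisensteinSeriesQ (-24) 1) where
  mdiff := E2_mdifferentiable
  hasSum τ := by
    simpa [eisensteinSeriesQ, Periodic.qParam] using hasSum_qExpansion_E2 (z := τ)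

lemma E_slash {k : ℕ} (hk : 3 ≤ k) (γ : SL(2, ℤ)) : (E hk : ℍ → ℂ) ∣[(k : ℤ)] γ = E hk :=
  SlashInvariantForm.slash_action_eqn (E hk) _ ⟨γ, rfl⟩

local notation "P" => eisensteinSeriesQ (-24) 1
local notation "Q" => eisensteinSeriesQ 240 3
local notation "R" => eisensteinSeriesQ (-504) 5
local notation "θ" => eulerDerivation

lemma hasQExpansion_E4 : HasQExpansion E₄ Q :=
  hasQExpansion_E _ ⟨2, rfl⟩ (by norm_num [show bernoulli 4 = -1 / 30 by decide +kernel])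

lemma hasQExpansion_E6 : HasQExpansion E₆ R :=
  hasQExpansion_E _ ⟨3, rfl⟩ (by norm_num [show bernoulli 6 = 1 / 42 by decide +kernel])

lemma hasQExpansion_E8 : HasQExpansion (E (show 3 ≤ 8 by norm_num)) (eisensteinSeriesQ 480 7) :=
  hasQExpansion_E _ ⟨4, rfl⟩ (by norm_num [show bernoulli 8 = -1 / 30 by decide +kernel])

lemma hasQExpansion_E10 :
    HasQExpansion (E (show 3 ≤ 10 by norm_num)) (eisensteinSeriesQ (-264) 9) :=
  hasQExpansion_E _ ⟨5, rfl⟩ (by norm_num [show bernoulli 10 = 5 / 66 by decide +kernel])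

lemma coeff_zero_eisensteinSeriesQ (c : ℂ) (j : ℕ) : (eisensteinSeriesQ c j).coeff 0 = 1 := by
  simp [eisensteinSeriesQ]

lemma sub_slash (k : ℤ) (f g : ℍ → ℂ) (γ : SL(2, ℤ)) : (f - g) ∣[k] γ = f ∣[k] γ - g ∣[k] γ := by
  rw [sub_eq_add_neg, SlashAction.add_slash, SlashAction.neg_slash, ← sub_eq_add_neg]

/-- Two level-one modular forms of the same weight less than `12` agree as soon as their constant
terms do. -/
lemma HasQExpansion.eq_of_slash_invariant {k : ℕ} (hk : k < 12) {f g : ℍ → ℂ}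
    {p r : PowerSeries ℂ} (hf : HasQExpansion f p) (hg : HasQExpansion g r)
    (hfs : ∀ γ : SL(2, ℤ), f ∣[(k : ℤ)] γ = f) (hgs : ∀ γ : SL(2, ℤ), g ∣[(k : ℤ)] γ = g)
    (h0 : p.coeff 0 = r.coeff 0) : p = r :=
  sub_eq_zero.mp <| (hf.sub hg).eq_zero_of_slash_invariant hk
    (fun γ ↦ by rw [sub_slash, hfs, hgs]) (by rw [map_sub, h0, sub_self])

lemma constantCoeff_eisensteinSeriesQ (c : ℂ) (j : ℕ) :
    PowerSeries.constantCoeff (eisensteinSeriesQ c j) = 1 := by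
  rw [← PowerSeries.coeff_zero_eq_constantCoeff_apply, coeff_zero_eisensteinSeriesQ]

/-! ### Ramanujan's differential equations -/

lemma Q_sq : Q * Q = eisensteinSeriesQ 480 7 := by
  refine (hasQExpansion_E4.mul hasQExpansion_E4).eq_of_slash_invariant (k := 8) (by norm_num)
    hasQExpansion_E8 (fun γ ↦ ?_) (E_slash _) ?_
  · exact (mul_slash_SL2 4 4 γ E₄ E₄).trans
      (congrArg₂ (· * ·) (E_slash (k := 4) _ γ) (E_slash (k := 4) _ γ))
  · simp [constantCoeff_eisensteinSeriesQ]

lemma Q_mul_R : Q * R = eisensteinSeriesQ (-264) 9 := by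
  refine (hasQExpansion_E4.mul hasQExpansion_E6).eq_of_slash_invariant (k := 10) (by norm_num)
    hasQExpansion_E10 (fun γ ↦ ?_) (E_slash _) ?_
  · exact (mul_slash_SL2 4 6 γ E₄ E₆).trans
      (congrArg₂ (· * ·) (E_slash (k := 4) _ γ) (E_slash (k := 6) _ γ))
  · simp [constantCoeff_eisensteinSeriesQ]

lemma HasQExpansion.serreDerivative {f : ℍ → ℂ} {p : PowerSeries ℂ} (hf : HasQExpansion f p)
    (c : ℂ) : HasQExpansion (serreDerivative c f) (θ p - (c / 12) • (P * p)) := by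
  convert! hf.normalizedDeriv.sub ((hasQExpansion_E2.mul hf).smul (c / 12)) using 1
  ext z
  simp [div_eq_mul_inv, mul_assoc]

lemma constantCoeff_eulerDerivation (p : PowerSeries ℂ) :
    PowerSeries.constantCoeff (θ p) = 0 := by
  rw [← PowerSeries.coeff_zero_eq_constantCoeff_apply, coeff_eulerDerivation]
  simp

lemma eulerDerivation_Q : θ Q = (1 / 3 : ℂ) • (P * Q - R) := by
  -- The Serre derivative of `E₄` is modular of weight `6`, with constant term `-4 / 12`.
  have h : θ Q - ((4 : ℤ) / 12 : ℂ) • (P * Q) = (-1 / 3 : ℂ) • R := by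
    refine (hasQExpansion_E4.serreDerivative (4 : ℤ)).eq_of_slash_invariant (k := 6) (by norm_num)
      (hasQExpansion_E6.smul _) (fun γ ↦ ?_) (fun γ ↦ ?_) ?_
    · exact serreDerivative_slash_invariant hasQExpansion_E4.mdiff (E_slash (k := 4) _ γ)
    · rw [SL_smul_slash, E_slash]
    · simp [constantCoeff_eisensteinSeriesQ, constantCoeff_eulerDerivation]
      norm_num
  rw [sub_eq_iff_eq_add] at h
  rw [h]
  push_cast
  module

lemma eulerDerivation_R : θ R = (1 / 2 : ℂ) • (P * R - Q * Q) := by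
  -- The Serre derivative of `E₆` is modular of weight `8`, with constant term `-6 / 12`.
  have h : θ R - ((6 : ℤ) / 12 : ℂ) • (P * R) = (-1 / 2 : ℂ) • eisensteinSeriesQ 480 7 := by
    refine (hasQExpansion_E6.serreDerivative (6 : ℤ)).eq_of_slash_invariant (k := 8) (by norm_num)
      (hasQExpansion_E8.smul _) (fun γ ↦ ?_) (fun γ ↦ ?_) ?_
    · exact serreDerivative_slash_invariant hasQExpansion_E6.mdiff (E_slash (k := 6) _ γ)
    · rw [SL_smul_slash, E_slash]
    · simp [constantCoeff_eisensteinSeriesQ, constantCoeff_eulerDerivation]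
      norm_num
  rw [sub_eq_iff_eq_add] at h
  rw [h, Q_sq]
  push_cast
  module

/-- The defect of modularity of `E2`, with the value of `ζ(2)` inserted. -/
lemma E2_slash_apply (γ : SL(2, ℤ)) (z : ℍ) :
    (E2 ∣[(2 : ℤ)] γ) z = E2 z - 6 * I / Real.pi * (γ 1 0 / denom γ z) := by
  have hpi : (Real.pi : ℂ) ≠ 0 := by exact_mod_cast Real.pi_ne_zero
  have hz := denom_ne_zero (γ : GL (Fin 2) ℝ) z
  rw [E2_slash_action]
  simp only [Pi.sub_apply, Pi.smul_apply, smul_eq_mul, D2, riemannZeta_two]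
  field_simp

lemma normalizedDerivOfComplex_E2_slash_apply (γ : SL(2, ℤ)) (z : ℍ) :
    normalizedDerivOfComplex (E2 ∣[(2 : ℤ)] γ) z =
      normalizedDerivOfComplex E2 z + 3 / Real.pi ^ 2 * (γ 1 0 / denom γ z) ^ 2 := by
  have hpi : (Real.pi : ℂ) ≠ 0 := by exact_mod_cast Real.pi_ne_zero
  have hz := denom_ne_zero (γ : GL (Fin 2) ℝ) z
  have hE := (UpperHalfPlane.mdifferentiableAt_iff.mp (E2_mdifferentiable z)).hasDerivAt
  have hd := (hasDerivAt_denom_zpow (γ : GL (Fin 2) ℝ) (-1) z).const_mul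
    (6 * I / Real.pi * γ 1 0)
  have heq : ((E2 ∣[(2 : ℤ)] γ) ∘ ofComplex) =ᶠ[𝓝 (z : ℂ)]
      fun w ↦ (E2 ∘ ofComplex) w - 6 * I / Real.pi * γ 1 0 * denom γ w ^ (-1 : ℤ) := by
    filter_upwards [isOpen_upperHalfPlaneSet.mem_nhds z.im_pos] with w hw
    simp only [comp_apply, ofComplex_apply_of_im_pos hw, E2_slash_apply, zpow_neg_one]
    ring
  rw [normalizedDerivOfComplex, ((hE.sub hd).congr_of_eventuallyEq heq).deriv,
    normalizedDerivOfComplex]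
  simp
  field_simp
  ring_nf
  simp only [I_sq]
  ring

/-- The weight of `E2` is `2`, but `D E2 - E2 ^ 2 / 12` is its Serre derivative with parameter `1`:
this is the parameter for which the two anomalies of `E2` and of `D E2` cancel. -/
lemma serreDerivative_one_E2_slash (γ : SL(2, ℤ)) :
    serreDerivative 1 E2 ∣[(4 : ℤ)] γ = serreDerivative 1 E2 := by
  have hsplit : serreDerivative 1 E2 = normalizedDerivOfComplex E2 - (1 / 12 : ℂ) • (E2 * E2) := by
    ext z
    simp [mul_assoc]
  have hmul : (E2 * E2) ∣[(4 : ℤ)] γ = (E2 ∣[(2 : ℤ)] γ) * (E2 ∣[(2 : ℤ)] γ) :=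
    mul_slash_SL2 2 2 γ E2 E2
  rw [hsplit, sub_slash, SL_smul_slash, hmul]
  ext z
  have hpi : (Real.pi : ℂ) ≠ 0 := by exact_mod_cast Real.pi_ne_zero
  have hD := congrFun (normalizedDerivOfComplex_SL_slash (k := 2) E2_mdifferentiable (γ := γ)) z
  rw [normalizedDerivOfComplex_E2_slash_apply] at hD
  simp only [Pi.sub_apply, Pi.smul_apply, Pi.mul_apply, smul_eq_mul, E2_slash_apply] at hD ⊢
  generalize (γ 1 0 / denom γ z : ℂ) = u at hD ⊢
  rw [eq_sub_iff_add_eq, show (2 : ℤ) + 2 = 4 from rfl] at hD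
  rw [← hD]
  push_cast
  field_simp
  ring_nf
  -- The terms in `u * E2 z` and in `u ^ 2` cancel because `I ^ 2 = -1`.
  simp only [I_sq, I_pow_three]
  ring

lemma eulerDerivation_P : θ P = (1 / 12 : ℂ) • (P * P - Q) := by
  have h : θ P - ((1 : ℂ) / 12 : ℂ) • (P * P) = (-1 / 12 : ℂ) • Q := by
    refine (hasQExpansion_E2.serreDerivative 1).eq_of_slash_invariant (k := 4) (by norm_num)
      (hasQExpansion_E4.smul _) serreDerivative_one_E2_slash (fun γ ↦ ?_) ?_
    · rw [SL_smul_slash, E_slash]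
    · simp [constantCoeff_eisensteinSeriesQ, constantCoeff_eulerDerivation]
      norm_num
  rw [sub_eq_iff_eq_add] at h
  rw [h]
  module

lemma qExpansion_discriminant_eq :
    qExpansion 1 discriminant = (1 / 1728 : ℂ) • (Q * Q * Q - R * R) := by
  have h := ((hasQExpansion_E4.mul hasQExpansion_E4).mul hasQExpansion_E4).sub
    (hasQExpansion_E6.mul hasQExpansion_E6) |>.smul (1 / 1728)
  rw [← h.qExpansion_eq]
  congr 1
  ext z
  rw [discriminant_eq_E₄_cube_sub_E₆_sq]
  simp only [Pi.smul_apply, Pi.sub_apply, Pi.mul_apply, smul_eq_mul]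
  ring

end QExpansions

/-! ### Differential algebra of Ramanujan's system -/

section RamanujanSystem

variable {K A : Type*} [CommRing K] [CommRing A] [Algebra K A]

lemma Derivation.map_ofNat' (D : Derivation K A A) (n : ℕ) [n.AtLeastTwo] :
    D (ofNat(n) : A) = 0 :=
  D.map_natCast (OfNat.ofNat n)

/-- Ramanujan's differential equations for `p = E₂ / 12`, `q = E₄ / 144`, `r = E₆ / 432`. In this
scaling all coefficients are integers, so that consequences can be checked in any commutative
ring. -/
structure IsRamanujanSystem (D : Derivation K A A) (p q r : A) : Prop where
  map_p : D p = p ^ 2 - q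
  map_q : D q = 4 * p * q - r
  map_r : D r = 6 * p * r - 24 * q ^ 2

namespace IsRamanujanSystem

variable {D : Derivation K A A} {p q r : A}

lemma iterate_p (h : IsRamanujanSystem D p q r) :
    D (D (D p)) = 6 * p ^ 4 - 36 * p ^ 2 * q + 12 * p * r - 18 * q ^ 2 ∧
    D (D (D (D p))) =
      24 * p ^ 5 - 240 * p ^ 3 * q + 120 * p ^ 2 * r - 360 * p * q ^ 2 + 24 * q * r ∧
    D (D (D (D (D p)))) = 120 * p ^ 6 - 1800 * p ^ 4 * q + 1200 * p ^ 3 * r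
      - 5400 * p ^ 2 * q ^ 2 + 720 * p * q * r - 216 * q ^ 3 - 24 * r ^ 2 ∧
    D (D (D (D (D (D p))))) = 720 * p ^ 7 - 15120 * p ^ 5 * q + 12600 * p ^ 4 * r
      - 75600 * p ^ 3 * q ^ 2 + 15120 * p ^ 2 * q * r - 9072 * p * q ^ 3 - 1008 * p * r ^ 2
      + 1080 * q ^ 2 * r := by
  have h2 : D (D p) = 2 * p ^ 3 - 6 * p * q + r := by
    simp only [h.map_p, h.map_q, map_sub, D.leibniz_pow, smul_eq_mul, nsmul_eq_mul]
    ring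
  have h3 : D (D (D p)) = 6 * p ^ 4 - 36 * p ^ 2 * q + 12 * p * r - 18 * q ^ 2 := by
    rw [h2]
    simp only [h.map_p, h.map_q, h.map_r, map_sub, map_add, D.leibniz, D.leibniz_pow,
      D.map_ofNat', smul_eq_mul, nsmul_eq_mul]
    ring
  have h4 : D (D (D (D p))) =
      24 * p ^ 5 - 240 * p ^ 3 * q + 120 * p ^ 2 * r - 360 * p * q ^ 2 + 24 * q * r := by
    rw [h3]
    simp only [h.map_p, h.map_q, h.map_r, map_sub, map_add, D.leibniz, D.leibniz_pow,
      D.map_ofNat', smul_eq_mul, nsmul_eq_mul]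
    ring
  have h5 : D (D (D (D (D p)))) = 120 * p ^ 6 - 1800 * p ^ 4 * q + 1200 * p ^ 3 * r
      - 5400 * p ^ 2 * q ^ 2 + 720 * p * q * r - 216 * q ^ 3 - 24 * r ^ 2 := by
    rw [h4]
    simp only [h.map_p, h.map_q, h.map_r, map_sub, map_add, D.leibniz, D.leibniz_pow,
      D.map_ofNat', smul_eq_mul, nsmul_eq_mul]
    ring
  refine ⟨h3, h4, h5, ?_⟩
  rw [h5]
  simp only [h.map_p, h.map_q, h.map_r, map_sub, map_add, D.leibniz, D.leibniz_pow,
    D.map_ofNat', smul_eq_mul, nsmul_eq_mul]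
  ring

lemma iterate_q (h : IsRamanujanSystem D p q r) :
    D (D q) = 20 * p ^ 2 * q - 10 * p * r + 20 * q ^ 2 ∧
    D (D (D q)) = 120 * p ^ 3 * q - 90 * p ^ 2 * r + 360 * p * q ^ 2 - 30 * q * r ∧
    D (D (D (D q))) = 840 * p ^ 4 * q - 840 * p ^ 3 * r + 5040 * p ^ 2 * q ^ 2
      - 840 * p * q * r + 360 * q ^ 3 + 30 * r ^ 2 ∧
    D (D (D (D (D q)))) = 6720 * p ^ 5 * q - 8400 * p ^ 4 * r + 67200 * p ^ 3 * q ^ 2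
      - 16800 * p ^ 2 * q * r + 14400 * p * q ^ 3 + 1200 * p * r ^ 2 - 1680 * q ^ 2 * r := by
  have h2 : D (D q) = 20 * p ^ 2 * q - 10 * p * r + 20 * q ^ 2 := by
    simp only [h.map_p, h.map_q, h.map_r, map_sub, D.leibniz, D.map_ofNat', smul_eq_mul]
    ring
  have h3 : D (D (D q)) = 120 * p ^ 3 * q - 90 * p ^ 2 * r + 360 * p * q ^ 2 - 30 * q * r := by
    rw [h2]
    simp only [h.map_p, h.map_q, h.map_r, map_sub, map_add, D.leibniz, D.leibniz_pow,
      D.map_ofNat', smul_eq_mul, nsmul_eq_mul]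
    ring
  have h4 : D (D (D (D q))) = 840 * p ^ 4 * q - 840 * p ^ 3 * r + 5040 * p ^ 2 * q ^ 2
      - 840 * p * q * r + 360 * q ^ 3 + 30 * r ^ 2 := by
    rw [h3]
    simp only [h.map_p, h.map_q, h.map_r, map_sub, map_add, D.leibniz, D.leibniz_pow,
      D.map_ofNat', smul_eq_mul, nsmul_eq_mul]
    ring
  refine ⟨h2, h3, h4, ?_⟩
  rw [h4]
  simp only [h.map_p, h.map_q, h.map_r, map_sub, map_add, D.leibniz, D.leibniz_pow,
    D.map_ofNat', smul_eq_mul, nsmul_eq_mul]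
  ring

lemma iterate_r (h : IsRamanujanSystem D p q r) :
    D (D r) = 42 * p ^ 2 * r - 336 * p * q ^ 2 + 42 * q * r ∧
    D (D (D r)) = 336 * p ^ 3 * r - 4032 * p ^ 2 * q ^ 2 + 1008 * p * q * r
      - 672 * q ^ 3 - 42 * r ^ 2 ∧
    D (D (D (D r))) = 3024 * p ^ 4 * r - 48384 * p ^ 3 * q ^ 2 + 18144 * p ^ 2 * q * r
      - 24192 * p * q ^ 3 - 1512 * p * r ^ 2 + 3024 * q ^ 2 * r := by
  have h2 : D (D r) = 42 * p ^ 2 * r - 336 * p * q ^ 2 + 42 * q * r := by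
    simp only [h.map_p, h.map_q, h.map_r, map_sub, D.leibniz, D.leibniz_pow, D.map_ofNat',
      smul_eq_mul, nsmul_eq_mul]
    ring
  have h3 : D (D (D r)) = 336 * p ^ 3 * r - 4032 * p ^ 2 * q ^ 2 + 1008 * p * q * r
      - 672 * q ^ 3 - 42 * r ^ 2 := by
    rw [h2]
    simp only [h.map_p, h.map_q, h.map_r, map_sub, map_add, D.leibniz, D.leibniz_pow,
      D.map_ofNat', smul_eq_mul, nsmul_eq_mul]
    ring
  refine ⟨h2, h3, ?_⟩
  rw [h3]
  simp only [h.map_p, h.map_q, h.map_r, map_sub, map_add, D.leibniz, D.leibniz_pow,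
    D.map_ofNat', smul_eq_mul, nsmul_eq_mul]
  ring

lemma iterate_q_mul_q (h : IsRamanujanSystem D p q r) :
    D (D (q * q)) = 72 * p ^ 2 * q ^ 2 - 36 * p * q * r + 40 * q ^ 3 + 2 * r ^ 2 ∧
    D (D (D (q * q))) = 720 * p ^ 3 * q ^ 2 - 540 * p ^ 2 * q * r + 1200 * p * q ^ 3
      + 60 * p * r ^ 2 - 180 * q ^ 2 * r := by
  have h2 : D (D (q * q)) = 72 * p ^ 2 * q ^ 2 - 36 * p * q * r + 40 * q ^ 3 + 2 * r ^ 2 := by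
    simp only [h.map_p, h.map_q, h.map_r, map_sub, map_add, D.leibniz, D.map_ofNat', smul_eq_mul]
    ring
  refine ⟨h2, ?_⟩
  rw [h2]
  simp only [h.map_p, h.map_q, h.map_r, map_sub, map_add, D.leibniz, D.leibniz_pow,
    D.map_ofNat', smul_eq_mul, nsmul_eq_mul]
  ring

lemma iterate_q_mul_r (h : IsRamanujanSystem D p q r) :
    D (D (q * r)) = 110 * p ^ 2 * q * r - 528 * p * q ^ 3 - 22 * p * r ^ 2 + 110 * q ^ 2 * r := by
  simp only [h.map_p, h.map_q, h.map_r, map_sub, map_add, D.leibniz, D.leibniz_pow,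
    D.map_ofNat', smul_eq_mul, nsmul_eq_mul]
  ring

/-- With `p = E₂ / 12`, the left side is `35 (1 - E₂) (D E₂)²`. The right side is linear in iterated
derivatives of Eisenstein series, and its coefficients can therefore be read off. -/
lemma one_sub_mul_sq (h : IsRamanujanSystem D p q r) :
    35 * ((1 - 12 * p) * (12 * D p) ^ 2) =
      -1440 * D (D r) - 4032 * D (D (D q)) + 1008 * D (D q) - 2520 * D (D (D (D p)))
        + 840 * D (D (D p)) := by
  obtain ⟨p3, p4, -, -⟩ := h.iterate_p
  obtain ⟨q2, q3, -, -⟩ := h.iterate_q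
  rw [p4, p3, q3, q2, h.iterate_r.1, h.map_p]
  ring

/-- With `p = E₂ / 12`, the left side is `-385 (1 - E₂)³ (D E₂)²`. On the right side, `q * q` and
`q * r` are multiples of `E₈` and `E₁₀`, and `1728 q ^ 3 - 108 r ^ 2` is the discriminant `Δ`. -/
lemma one_sub_cube_mul_sq (h : IsRamanujanSystem D p q r) :
    -385 * ((1 - 12 * p) ^ 3 * (12 * D p) ^ 2) =
      870912 * D (D (q * r)) + 2128896 * D (D (D (q * q))) - 1330560 * D (D (q * q))
        + 198000 * D (D (D (D r))) - 213840 * D (D (D r)) + 47520 * D (D r)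
        + 270864 * D (D (D (D (D q)))) - 370656 * D (D (D (D q))) + 133056 * D (D (D q))
        - 11088 * D (D q)
        + 133056 * D (D (D (D (D (D p))))) - 199584 * D (D (D (D (D p))))
        + 83160 * D (D (D (D p))) - 9240 * D (D (D p))
        + 88 * (D (1728 * q ^ 3 - 108 * r ^ 2) - (1728 * q ^ 3 - 108 * r ^ 2)) := by
  obtain ⟨p3, p4, p5, p6⟩ := h.iterate_p
  obtain ⟨q2, q3, q4, q5⟩ := h.iterate_q
  obtain ⟨r2, r3, r4⟩ := h.iterate_r
  obtain ⟨qq2, qq3⟩ := h.iterate_q_mul_q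
  -- The logarithmic derivative of the discriminant is `E₂ = 12 p`.
  have hΔ : D (1728 * q ^ 3 - 108 * r ^ 2) = 12 * p * (1728 * q ^ 3 - 108 * r ^ 2) := by
    simp only [h.map_q, h.map_r, map_sub, D.leibniz, D.leibniz_pow,
      D.map_ofNat', smul_eq_mul, nsmul_eq_mul]
    ring
  rw [p6, p5, p4, p3, q5, q4, q3, q2, r4, r3, r2, qq3, qq2, h.iterate_q_mul_r, hΔ, h.map_p]
  ring

end IsRamanujanSystem

end RamanujanSystem

/-! ### The Eisenstein series as a Ramanujan system -/

section LahiriSums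

open UpperHalfPlane

local notation "P" => eisensteinSeriesQ (-24) 1
local notation "Q" => eisensteinSeriesQ 240 3
local notation "R" => eisensteinSeriesQ (-504) 5
local notation "θ" => eulerDerivation

lemma PowerSeries.ofNat_mul_eq_smul (k : ℕ) [k.AtLeastTwo] (p : PowerSeries ℂ) :
    ofNat(k) * p = (ofNat(k) : ℂ) • p := by
  rw [Algebra.smul_def, map_ofNat]

lemma isRamanujanSystem_eulerDerivation :
    IsRamanujanSystem θ ((1 / 12 : ℂ) • P) ((1 / 144 : ℂ) • Q) ((1 / 432 : ℂ) • R) where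
  map_p := by
    rw [Derivation.map_smul, eulerDerivation_P]
    simp only [pow_two, mul_smul_comm, smul_mul_assoc]
    module
  map_q := by
    rw [Derivation.map_smul, eulerDerivation_Q]
    simp only [mul_smul_comm, smul_mul_assoc, PowerSeries.ofNat_mul_eq_smul]
    module
  map_r := by
    rw [Derivation.map_smul, eulerDerivation_R]
    simp only [pow_two, mul_smul_comm, smul_mul_assoc, PowerSeries.ofNat_mul_eq_smul]
    module

lemma twelve_mul_smul_P : 12 * ((1 / 12 : ℂ) • P) = P := by
  rw [PowerSeries.ofNat_mul_eq_smul, smul_smul]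
  norm_num

lemma twelve_mul_eulerDerivation_smul_P : 12 * θ ((1 / 12 : ℂ) • P) = θ P := by
  rw [Derivation.map_smul, PowerSeries.ofNat_mul_eq_smul, smul_smul]
  norm_num

/-! ### Convolution sums as coefficients of products -/

lemma coeff_prod_mk {S : Type*} [CommSemiring S] {k : ℕ} (c : Fin k → ℕ → S) (n : ℕ) :
    (∏ i, PowerSeries.mk (c i)).coeff n =
      ∑ m ∈ Finset.Nat.antidiagonalTuple k n, ∏ i, c i (m i) := by
  rw [PowerSeries.coeff_prod]
  refine Finset.sum_equiv Finsupp.equivFunOnFinite (fun l ↦ ?_) (fun l _ ↦ by simp)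
  simp [Finset.mem_finsuppAntidiag, Finset.Nat.mem_antidiagonalTuple]

/-- A convolution sum is a coefficient of the product of the generating series of its factors. -/
lemma cast_lahiriSum {k : ℕ} (a b : Fin k → ℕ) (n : ℕ) :
    (lahiriSum a b n : ℂ) =
      (∏ i, PowerSeries.mk fun m ↦ (m : ℂ) ^ a i * sigma (b i) m).coeff n := by
  rw [coeff_prod_mk]
  simp [lahiriSum, lahiriSumLevel, sigmaQuot]

lemma mk_sigma_one : PowerSeries.mk (fun m ↦ (sigma 1 m : ℂ)) = (1 / 24 : ℂ) • (1 - P) := by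
  ext n
  rcases eq_or_ne n 0 with rfl | hn
  · simp [eisensteinSeriesQ]
  · simp [eisensteinSeriesQ, hn, PowerSeries.coeff_one]

lemma mk_mul_sigma_one :
    PowerSeries.mk (fun m ↦ (m * sigma 1 m : ℂ)) = (-1 / 24 : ℂ) • θ P := by
  ext n
  rcases eq_or_ne n 0 with rfl | hn
  · simp [constantCoeff_eulerDerivation]
  · simp [coeff_eulerDerivation, eisensteinSeriesQ, hn]
    ring

lemma coeff_eisensteinSeriesQ (c : ℂ) (j : ℕ) {n : ℕ} (hn : n ≠ 0) :
    (eisensteinSeriesQ c j).coeff n = c * sigma j n := by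
  simp [eisensteinSeriesQ, hn]

lemma qExpansion_discriminant_eq_smul_pow : qExpansion 1 ModularForm.discriminant =
    1728 * ((1 / 144 : ℂ) • Q) ^ 3 - 108 * ((1 / 432 : ℂ) • R) ^ 2 := by
  rw [qExpansion_discriminant_eq]
  simp only [pow_succ, pow_zero, one_mul, mul_smul_comm, smul_mul_assoc,
    PowerSeries.ofNat_mul_eq_smul]
  module

lemma cast_lahiriSum_three {n : ℕ} (hn : n ≠ 0) :
    (lahiriSum ![0, 1, 1] ![1, 1, 1] n : ℂ) =
      1 / 288 * n ^ 2 * sigma 5 n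
        - 1 / 72 * n ^ 3 * sigma 3 n
        + 1 / 288 * n ^ 2 * sigma 3 n
        + 1 / 96 * n ^ 4 * sigma 1 n
        - 1 / 288 * n ^ 3 * sigma 1 n := by
  -- `∑ σ₁(m) q^m = (1 - P) / 24` and `∑ m σ₁(m) q^m = -θ P / 24`.
  have hS : (lahiriSum ![0, 1, 1] ![1, 1, 1] n : ℂ) =
      1 / 24 ^ 3 * ((1 - P) * θ P ^ 2).coeff n := by
    rw [cast_lahiriSum, ← smul_eq_mul, ← PowerSeries.coeff_smul]
    congr 1
    simp only [Fin.prod_univ_succ]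
    simp [mk_sigma_one, mk_mul_sigma_one, pow_two, smul_smul]
    norm_num
  have h := congrArg (PowerSeries.coeff n) isRamanujanSystem_eulerDerivation.one_sub_mul_sq
  rw [twelve_mul_smul_P, twelve_mul_eulerDerivation_smul_P] at h
  simp only [map_add, map_sub, map_neg, neg_mul, PowerSeries.ofNat_mul_eq_smul,
    PowerSeries.coeff_smul, coeff_eulerDerivation, coeff_eisensteinSeriesQ _ _ hn, smul_eq_mul] at h
  rw [hS]
  linear_combination h / (35 * 24 ^ 3)

lemma cast_lahiriSum_five {n : ℕ} (hn : n ≠ 0) :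
    -24 ^ 5 * (lahiriSum ![0, 0, 0, 1, 1] ![1, 1, 1, 1, 1] n : ℂ) =
      -(48 / 5) * n ^ 2 * sigma 9 n
        + 128 * n ^ 3 * sigma 7 n
        + (-80 * n ^ 2 * sigma 7 n - 600 * n ^ 4 * sigma 5 n)
        + (648 * n ^ 3 * sigma 5 n + 8208 / 7 * n ^ 5 * sigma 3 n)
        + (-144 * n ^ 2 * sigma 5 n - 11232 / 7 * n ^ 4 * sigma 3 n
            - 3456 / 5 * n ^ 6 * sigma 1 n)
        + (576 * n ^ 3 * sigma 3 n + 5184 / 5 * n ^ 5 * sigma 1 n)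
        + (-432 * n ^ 4 * sigma 1 n - 48 * n ^ 2 * sigma 3 n)
        + 48 * n ^ 3 * sigma 1 n
        + 8 / 35 * n * ramanujanTau n
        - 8 / 35 * ramanujanTau n := by
  have hS : (lahiriSum ![0, 0, 0, 1, 1] ![1, 1, 1, 1, 1] n : ℂ) =
      1 / 24 ^ 5 * ((1 - P) ^ 3 * θ P ^ 2).coeff n := by
    rw [cast_lahiriSum, ← smul_eq_mul, ← PowerSeries.coeff_smul]
    congr 1
    simp only [Fin.prod_univ_succ]
    simp [mk_sigma_one, mk_mul_sigma_one, pow_succ, smul_smul, mul_assoc]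
    norm_num
  have hQQ : ((1 / 144 : ℂ) • Q) * ((1 / 144 : ℂ) • Q) =
      (1 / 20736 : ℂ) • eisensteinSeriesQ 480 7 := by
    rw [smul_mul_smul_comm, Q_sq]
    norm_num
  have hQR : ((1 / 144 : ℂ) • Q) * ((1 / 432 : ℂ) • R) =
      (1 / 62208 : ℂ) • eisensteinSeriesQ (-264) 9 := by
    rw [smul_mul_smul_comm, Q_mul_R]
    norm_num
  have h := congrArg (PowerSeries.coeff n) isRamanujanSystem_eulerDerivation.one_sub_cube_mul_sq
  rw [twelve_mul_smul_P, twelve_mul_eulerDerivation_smul_P, hQQ, hQR,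
    ← qExpansion_discriminant_eq_smul_pow] at h
  simp only [map_add, map_sub, map_neg, neg_mul, PowerSeries.ofNat_mul_eq_smul,
    PowerSeries.coeff_smul, coeff_eulerDerivation, coeff_eisensteinSeriesQ _ _ hn, smul_eq_mul] at h
  rw [hS, ramanujanTau]
  linear_combination h / 385

end LahiriSums

theorem mainTheorem7 (n : ℕ) (hn : 0 < n) :
    ((lahiriSum ![0, 1, 1] ![1, 1, 1] n : ℚ) =
      1 / 288 * n ^ 2 * sigma 5 n
        - 1 / 72 * n ^ 3 * sigma 3 n
        + 1 / 288 * n ^ 2 * sigma 3 n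
        + 1 / 96 * n ^ 4 * sigma 1 n
        - 1 / 288 * n ^ 3 * sigma 1 n) ∧
    (-24 ^ 5 * (lahiriSum ![0, 0, 0, 1, 1] ![1, 1, 1, 1, 1] n : ℂ) =
      -(48 / 5) * n ^ 2 * sigma 9 n
        + 128 * n ^ 3 * sigma 7 n
        + (-80 * n ^ 2 * sigma 7 n - 600 * n ^ 4 * sigma 5 n)
        + (648 * n ^ 3 * sigma 5 n + 8208 / 7 * n ^ 5 * sigma 3 n)
        + (-144 * n ^ 2 * sigma 5 n - 11232 / 7 * n ^ 4 * sigma 3 n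
            - 3456 / 5 * n ^ 6 * sigma 1 n)
        + (576 * n ^ 3 * sigma 3 n + 5184 / 5 * n ^ 5 * sigma 1 n)
        + (-432 * n ^ 4 * sigma 1 n - 48 * n ^ 2 * sigma 3 n)
        + 48 * n ^ 3 * sigma 1 n
        + 8 / 35 * n * ramanujanTau n
        - 8 / 35 * ramanujanTau n) := by
  refine ⟨?_, cast_lahiriSum_five hn.ne'⟩
  have h := cast_lahiriSum_three hn.ne'
  apply Rat.cast_injective (α := ℂ)
  push_cast
  exact h
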